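/- Let $d, r$ be positive integers with $d \geq 2$, let $\alpha \in (0,1]$, let $m$ be a non-negative integer, set $N := d^m$, and suppose that $N \geq (2/\alpha)^{(32d)^r}$. Let $t_1, \dots, t_r$ be integers with $|t_j| \leq N$ for all $j$. For $\mathbf{y} = (y_i)_{0 \le i < m} \in \{0,1\}^m$ write $L_d(\mathbf{y}) := \sum_{i=0}^{m-1} y_i d^i$. Suppose that $A \subset (\{0,1\}^m)^r$ is a set of size at least $\alpha 2^{mr}$. Then at least $(\alpha/2)^{(32d)^r} N^r$ integers $x$ with $|x| \leq (8dN)^r$ may be written in the form $x = \sum_{i=1}^{k} \varepsilon_i p_i$ with $k \leq (4d)^r$, $\varepsilon_i \in \{-1, 1\}$, and each $p_i$ a number of the form $\prod_{j=1}^r (L_d(\mathbf{y}_j) + t_j)$ with $(\mathbf{y}_1, \dots, \mathbf{y}_r) \in A$ (repetitions being allowed). -/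

import Mathlib

/-- The linear form `L_d(y) = ∑_{0 ≤ i < m} y_i d^i` on the cube `{0,1}^m`. -/
def linForm (d : ℕ) {m : ℕ} (y : Fin m → Fin 2) : ℤ :=
  ∑ i : Fin m, ((y i : ℕ) : ℤ) * (d : ℤ) ^ (i : ℕ)

/-- `x` is a `±` sum of at most `s` elements of `S` (repetitions allowed, signs arbitrary):
`x = ε_1 a_1 + ⋯ + ε_k a_k` with `k ≤ s`, all `ε_i = ±1` and all `a_i ∈ S`. -/
def IsSignedSumOfAtMost (s : ℕ) (S : Set ℤ) (x : ℤ) : Prop :=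
  ∃ k : ℕ, k ≤ s ∧ ∃ (ε : Fin k → ℤˣ) (a : Fin k → ℤ),
    (∀ i, a i ∈ S) ∧ x = ∑ i, (ε i : ℤ) * a i

/-- The set of products `∏_j (L_d(y_j) + t_j)` with `(y_1, …, y_r) ∈ A`. -/
def shiftedProducts (d : ℕ) {r m : ℕ} (t : Fin r → ℤ)
    (A : Finset (Fin r → Fin m → Fin 2)) : Set ℤ :=
  {z : ℤ | ∃ y ∈ A, z = ∏ j : Fin r, (linForm d (y j) + t j)}

/-!
The proof is by induction on the number `r` of factors.

For `r = 1`, a set `A ⊆ {0,1}^m` of density `α` has a `k`-fold sumset of density at least `α ^ k` in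
`{0, …, k}^m` (`card_pow_mul_le_card_digitSumset`). This follows from a discrete inequality of
Prékopa–Leindler type, `sum_mul_sum_le_of_mul_le`: if `f x * g y ≤ h (x + y)` for all
`x ∈ {0,1}^m`, `y ∈ {0, …, k}^m`, then the average of `h` is at least the product of the averages of
`f` and `g`. It tensorises, so only the case `m = 1` needs an argument. Taking `k = d - 1` and using
that `L_d` is injective on digits below `d`, one finds at least `α ^ (d - 1) * d ^ m` integers.

For the step from `r` to `r + 1`, at least a proportion `α / 2` of the points `y` in the first
coordinate have a fibre `A_y` of density at least `α / 2` (`card_dense_fibres`), and by induction each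
such fibre yields a set `X_y` of signed sums that occupies a positive proportion of
`[-(8dN)^r, (8dN)^r]`. Among these `y` there are two, `y₁` and `y₂`, that agree in all but a bounded
number of low digits and for which `z₂` is comparable to `N`, where `z_i = L_d(y_i) + t_0`
(`exists_close_pair`). The gcd of `z₁` and `z₂` divides `z₁ - z₂ ≠ 0`, hence is bounded. The numbers
`x₁ z₁ + x₂ z₂` with `x_i ∈ X_{y_i}` are signed sums of the required kind. If such a sum is
prescribed, `x₁` lies in a fixed residue class modulo `z₂ / gcd(z₁, z₂)`, which leaves `O(N ^ (r - 1))`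
choices; since there are `≫ N ^ (2 r)` pairs, there are `≫ N ^ (r + 1)` different sums
(`card_mul_card_mul_le`). The lower bound on `N` serves only to ensure that `m` is at least the number
of low digits in which `y₁` and `y₂` may differ.
-/

/-! ### A Prékopa–Leindler type inequality on digit cubes -/

lemma pow_mul_pow_add_le {a b : ℝ} (ha : 0 ≤ a) (hb : 0 ≤ b) (i j : ℕ) :
    a ^ i * b ^ j + a ^ j * b ^ i ≤ a ^ (i + j) + b ^ (i + j) := by
  have key : 0 ≤ (a ^ i - b ^ i) * (a ^ j - b ^ j) := by
    rcases le_total a b with h | h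
    · exact mul_nonneg_of_nonpos_of_nonpos
        (sub_nonpos.2 (pow_le_pow_left₀ ha h i)) (sub_nonpos.2 (pow_le_pow_left₀ ha h j))
    · exact mul_nonneg
        (sub_nonneg.2 (pow_le_pow_left₀ hb h i)) (sub_nonneg.2 (pow_le_pow_left₀ hb h j))
  rw [pow_add, pow_add]
  linarith

/-- The averages of the monomials `a ^ i * b ^ (n - i)` satisfy
`(a + b) / 2 * avg_k ≤ avg_{k+1}`. -/
lemma add_mul_geomSum_le {a b : ℝ} (ha : 0 ≤ a) (hb : 0 ≤ b) (k : ℕ) :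
    (k + 2 : ℝ) * (a + b) * ∑ i ∈ Finset.range (k + 1), a ^ i * b ^ (k - i) ≤
      2 * (k + 1) * ∑ i ∈ Finset.range (k + 2), a ^ i * b ^ (k + 1 - i) := by
  set T := ∑ i ∈ Finset.range (k + 1), a ^ i * b ^ (k - i) with hT
  set S := ∑ i ∈ Finset.range (k + 2), a ^ i * b ^ (k + 1 - i) with hS
  have h1 : S = a ^ (k + 1) + b * T := by
    have := geom_sum₂_succ_eq a b (n := k + 1)
    simpa using this
  have h2 : S = a * T + b ^ (k + 1) := by
    rw [hS, Finset.sum_range_succ', hT, Finset.mul_sum]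
    simp only [pow_zero, one_mul, Nat.sub_zero, Nat.add_sub_add_right]
    congr 1
    exact Finset.sum_congr rfl fun i _ => by ring
  have h3 : S + S ≤ (k + 2) * (a ^ (k + 1) + b ^ (k + 1)) := by
    have hrefl : S = ∑ i ∈ Finset.range (k + 2), a ^ (k + 1 - i) * b ^ i := by
      rw [hS, ← Finset.sum_range_reflect]
      refine Finset.sum_congr rfl fun i hi => ?_
      have := Finset.mem_range.1 hi
      congr 2
      omega
    calc S + S = ∑ i ∈ Finset.range (k + 2),
          (a ^ i * b ^ (k + 1 - i) + a ^ (k + 1 - i) * b ^ i) := by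
          rw [Finset.sum_add_distrib, ← hrefl]
      _ ≤ ∑ i ∈ Finset.range (k + 2), (a ^ (k + 1) + b ^ (k + 1)) := by
          refine Finset.sum_le_sum fun i hi => ?_
          have := Finset.mem_range.1 hi
          have h := pow_mul_pow_add_le ha hb i (k + 1 - i)
          rwa [show i + (k + 1 - i) = k + 1 by omega] at h
      _ = _ := by simp; ring
  nlinarith

/-- The one-dimensional case: `a`, `b` are the values of a function on `{0, 1}`, `β` is a function
on `{0, …, k}`, and `h` on `{0, …, k + 1}` dominates their products along addition. -/
lemma add_mul_sum_le_of_mul_le {k : ℕ} {a b : ℝ} (ha : 0 ≤ a) (hb : 0 ≤ b)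
    {β : Fin (k + 1) → ℝ} {h : Fin (k + 2) → ℝ} (hβ : ∀ j, 0 ≤ β j) (hh : ∀ j, 0 ≤ h j)
    (h0 : ∀ j, a * β j ≤ h j.castSucc) (h1 : ∀ j, b * β j ≤ h j.succ) :
    (k + 2 : ℝ) * ((a + b) * ∑ j, β j) ≤ 2 * (k + 1) * ∑ j, h j := by
  have hhs : 0 ≤ ∑ j, h j := Finset.sum_nonneg fun j _ => hh j
  have hβs : 0 ≤ ∑ j, β j := Finset.sum_nonneg fun j _ => hβ j
  -- Each `h j` is bounded below by a convex combination of `a * β j` and `b * β (j - 1)`; the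
  -- weights `1 - V j / V (k + 1)` and `V j / V (k + 1)` make the coefficient of every `β j` equal.
  set V : ℕ → ℝ := fun j => ∑ i ∈ Finset.range j, a ^ i * b ^ (k - i) with hV
  set S := ∑ i ∈ Finset.range (k + 2), a ^ i * b ^ (k + 1 - i) with hS
  have hterm : ∀ i, 0 ≤ a ^ i * b ^ (k - i) := fun i => by positivity
  have hVnn : ∀ j, 0 ≤ V j := fun j => Finset.sum_nonneg fun i _ => hterm i
  have hVle : ∀ j ≤ k + 1, V j ≤ V (k + 1) := fun j hj =>
    Finset.sum_le_sum_of_subset_of_nonneg (Finset.range_mono hj) fun i _ _ => hterm i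
  have hcoef : ∀ j, j ≤ k → a * (V (k + 1) - V j) + b * V (j + 1) = S := by
    intro j
    induction j with
    | zero =>
      intro _
      rw [hS, Finset.sum_range_succ', hV]
      simp only [zero_add, Finset.sum_range_zero, Finset.sum_range_one, pow_zero, one_mul,
        Nat.sub_zero, Nat.add_sub_add_right, sub_zero, Finset.mul_sum]
      congr 1
      · exact Finset.sum_congr rfl fun i _ => by ring
      · ring
    | succ j ih =>
      intro hj
      have h2 := ih (by omega)
      have e1 : V (j + 1) = V j + a ^ j * b ^ (k - j) := Finset.sum_range_succ _ _
      have e2 : V (j + 2) = V (j + 1) + a ^ (j + 1) * b ^ (k - (j + 1)) :=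
        Finset.sum_range_succ _ _
      have e3 : b ^ (k - j) = b * b ^ (k - (j + 1)) := by
        rw [← pow_succ']; congr 1; omega
      have e4 : a * (a ^ j * b ^ (k - j)) = b * (a ^ (j + 1) * b ^ (k - (j + 1))) := by
        rw [e3]; ring
      show a * (V (k + 1) - V (j + 1)) + b * V (j + 2) = S
      linear_combination h2 + b * e2 - a * e1 - e4
  have hmain : S * ∑ j, β j ≤ V (k + 1) * ∑ j, h j := by
    have e1 : ∑ j : Fin (k + 2), (V (k + 1) - V j) * h j
        = ∑ j : Fin (k + 1), (V (k + 1) - V j) * h j.castSucc := by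
      rw [Fin.sum_univ_castSucc]; simp
    have e2 : ∑ j : Fin (k + 2), V j * h j = ∑ j : Fin (k + 1), V (j + 1) * h j.succ := by
      rw [Fin.sum_univ_succ]; simp [hV]
    have e3 : V (k + 1) * ∑ j, h j = ∑ j : Fin (k + 2), (V (k + 1) - V j) * h j
        + ∑ j : Fin (k + 2), V j * h j := by
      rw [Finset.mul_sum, ← Finset.sum_add_distrib]
      exact Finset.sum_congr rfl fun j _ => by ring
    rw [e3, e1, e2, Finset.mul_sum, ← Finset.sum_add_distrib]
    refine Finset.sum_le_sum fun j _ => ?_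
    have hj := j.2
    have p1 := mul_le_mul_of_nonneg_left (h0 j) (sub_nonneg.2 (hVle j (by omega)))
    have p2 := mul_le_mul_of_nonneg_left (h1 j) (hVnn (j + 1))
    rw [← hcoef j (by omega)]
    linarith
  have hVS : (k + 2 : ℝ) * (a + b) * V (k + 1) ≤ 2 * (k + 1) * S := add_mul_geomSum_le ha hb k
  by_cases hab : a = 0 ∧ b = 0
  · rw [hab.1, hab.2]
    simp only [add_zero, zero_mul, mul_zero]
    positivity
  have hVpos : 0 < V (k + 1) := by
    rcases not_and_or.1 hab with h | h
    · have : 0 < a ^ k * b ^ (k - k) := by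
        rw [Nat.sub_self, pow_zero, mul_one]
        exact pow_pos (lt_of_le_of_ne ha (Ne.symm h)) k
      exact this.trans_le (Finset.single_le_sum (f := fun i => a ^ i * b ^ (k - i))
        (fun i _ => hterm i) (Finset.self_mem_range_succ k))
    · have : 0 < a ^ 0 * b ^ (k - 0) := by
        rw [pow_zero, one_mul]
        exact pow_pos (lt_of_le_of_ne hb (Ne.symm h)) _
      exact this.trans_le (Finset.single_le_sum (f := fun i => a ^ i * b ^ (k - i))
        (fun i _ => hterm i) (by simp))
  refine le_of_mul_le_mul_left ?_ hVpos
  calc V (k + 1) * ((k + 2 : ℝ) * ((a + b) * ∑ j, β j))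
      = ((k + 2 : ℝ) * (a + b) * V (k + 1)) * ∑ j, β j := by ring
    _ ≤ (2 * (k + 1) * S) * ∑ j, β j := mul_le_mul_of_nonneg_right hVS hβs
    _ = 2 * (k + 1) * (S * ∑ j, β j) := by ring
    _ ≤ 2 * (k + 1) * (V (k + 1) * ∑ j, h j) := by gcongr
    _ = _ := by ring

lemma sum_fin_succ_pi {m n : ℕ} {M : Type*} [AddCommMonoid M] (F : (Fin (m + 1) → Fin n) → M) :
    ∑ z, F z = ∑ j : Fin n, ∑ w : Fin m → Fin n, F (Fin.cons j w) := by
  rw [← Fintype.sum_prod_type']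
  exact (Fintype.sum_equiv (Fin.consEquiv fun _ : Fin (m + 1) => Fin n) _ _ fun _ => rfl).symm

/-- If `f x * g y ≤ h (x + y)` on `{0, 1}^m × {0, …, k}^m`, then the average of `h` over
`{0, …, k + 1}^m` is at least the product of the averages of `f` and `g`. -/
theorem sum_mul_sum_le_of_mul_le {k : ℕ} : ∀ (m : ℕ) (f : (Fin m → Fin 2) → ℝ)
    (g : (Fin m → Fin (k + 1)) → ℝ) (h : (Fin m → Fin (k + 2)) → ℝ),
    (∀ x, 0 ≤ f x) → (∀ y, 0 ≤ g y) → (∀ z, 0 ≤ h z) →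
    (∀ x y z, (∀ i, (z i : ℕ) = x i + y i) → f x * g y ≤ h z) →
    (k + 2 : ℝ) ^ m * ((∑ x, f x) * ∑ y, g y) ≤ (2 * (k + 1)) ^ m * ∑ z, h z := by
  intro m
  induction m with
  | zero =>
    intro f g h _ _ _ hfg
    simp only [pow_zero, one_mul, Fintype.sum_unique]
    exact hfg _ _ _ fun i => i.elim0
  | succ m ih =>
    intro f g h hf hg hh hfg
    have step : ∀ (a : Fin 2) (j : Fin (k + 1)) (l : Fin (k + 2)), (l : ℕ) = a + j →
        (k + 2 : ℝ) ^ m * ((∑ x : Fin m → Fin 2, f (Fin.cons a x)) *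
          ∑ y : Fin m → Fin (k + 1), g (Fin.cons j y))
        ≤ (2 * (k + 1)) ^ m * ∑ z : Fin m → Fin (k + 2), h (Fin.cons l z) := by
      intro a j l hl
      refine ih _ _ _ (fun _ => hf _) (fun _ => hg _) (fun _ => hh _) fun x y z hz => hfg _ _ _ ?_
      intro i
      refine Fin.cases ?_ (fun i => ?_) i
      · simpa using hl
      · simpa using hz i
    have key := add_mul_sum_le_of_mul_le (k := k)
      (a := (k + 2 : ℝ) ^ m * ∑ x : Fin m → Fin 2, f (Fin.cons 0 x))
      (b := (k + 2 : ℝ) ^ m * ∑ x : Fin m → Fin 2, f (Fin.cons 1 x))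
      (β := fun j => ∑ y : Fin m → Fin (k + 1), g (Fin.cons j y))
      (h := fun l => (2 * (k + 1)) ^ m * ∑ z : Fin m → Fin (k + 2), h (Fin.cons l z))
      (mul_nonneg (by positivity) (Finset.sum_nonneg fun _ _ => hf _))
      (mul_nonneg (by positivity) (Finset.sum_nonneg fun _ _ => hf _))
      (fun j => Finset.sum_nonneg fun _ _ => hg _)
      (fun j => mul_nonneg (by positivity) (Finset.sum_nonneg fun _ _ => hh _))
      (fun j => by
        have := step 0 j j.castSucc (by simp)
        simpa only [mul_assoc] using this)
      (fun j => by
        have := step 1 j j.succ (by simp [add_comm])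
        simpa only [mul_assoc] using this)
    rw [sum_fin_succ_pi f, sum_fin_succ_pi g, sum_fin_succ_pi h, Fin.sum_univ_two]
    rw [← Finset.mul_sum] at key
    calc _ = (k + 2 : ℝ) * (((k + 2 : ℝ) ^ m * ∑ x : Fin m → Fin 2, f (Fin.cons 0 x)
          + (k + 2 : ℝ) ^ m * ∑ x : Fin m → Fin 2, f (Fin.cons 1 x)) *
          ∑ j, ∑ y : Fin m → Fin (k + 1), g (Fin.cons j y)) := by ring
      _ ≤ _ := key
      _ = _ := by ring

/-! ### Sumsets in the cube -/

open Classical in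
/-- The `k`-fold sumset of `A ⊆ {0, 1}^m`, as a subset of `{0, …, k}^m`. -/
noncomputable def digitSumset {m : ℕ} (A : Finset (Fin m → Fin 2)) (k : ℕ) :
    Finset (Fin m → Fin (k + 1)) :=
  Finset.univ.filter fun z => ∃ a : Fin k → Fin m → Fin 2,
    (∀ j, a j ∈ A) ∧ ∀ i, (z i : ℕ) = ∑ j, (a j i : ℕ)

lemma mem_digitSumset {m k : ℕ} {A : Finset (Fin m → Fin 2)} {z : Fin m → Fin (k + 1)} :
    z ∈ digitSumset A k ↔ ∃ a : Fin k → Fin m → Fin 2,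
      (∀ j, a j ∈ A) ∧ ∀ i, (z i : ℕ) = ∑ j, (a j i : ℕ) := by
  simp [digitSumset]

lemma card_mul_card_digitSumset_le {m : ℕ} (A : Finset (Fin m → Fin 2)) (k : ℕ) :
    (k + 2 : ℝ) ^ m * (A.card * (digitSumset A k).card) ≤
      (2 * (k + 1)) ^ m * (digitSumset A (k + 1)).card := by
  classical
  have key := sum_mul_sum_le_of_mul_le m
    (fun x => if x ∈ A then (1 : ℝ) else 0)
    (fun y => if y ∈ digitSumset A k then (1 : ℝ) else 0)
    (fun z => if z ∈ digitSumset A (k + 1) then (1 : ℝ) else 0)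
    (fun x => by positivity) (fun x => by positivity) (fun x => by positivity) (by
      intro x y z hz
      by_cases hx : x ∈ A
      swap
      · rw [if_neg hx, zero_mul]; positivity
      by_cases hy : y ∈ digitSumset A k
      swap
      · rw [if_neg hy, mul_zero]; positivity
      have : z ∈ digitSumset A (k + 1) := by
        obtain ⟨a, ha, hy⟩ := mem_digitSumset.1 hy
        refine mem_digitSumset.2 ⟨Fin.cons x a, fun j => ?_, fun i => ?_⟩
        · refine Fin.cases ?_ (fun j => ?_) j
          · simpa using hx
          · simpa using ha j
        · rw [Fin.sum_univ_succ]
          simp only [Fin.cons_zero, Fin.cons_succ]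
          rw [hz, hy]
      rw [if_pos hx, if_pos hy, if_pos this, one_mul])
  simpa using key

/-- A set of density `α` in `{0, 1}^m` has a `k`-fold sumset of density at least `α ^ k` in
`{0, …, k}^m`. -/
theorem card_pow_mul_le_card_digitSumset {m : ℕ} (A : Finset (Fin m → Fin 2)) (k : ℕ) :
    (A.card : ℝ) ^ k * (k + 1) ^ m ≤ (2 ^ m) ^ k * (digitSumset A k).card := by
  induction k with
  | zero =>
    have : (0 : Fin m → Fin 1) ∈ digitSumset A 0 :=
      mem_digitSumset.2 ⟨Fin.elim0, fun j => j.elim0, fun i => by simp⟩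
    have h1 : 1 ≤ (digitSumset A 0).card := Finset.card_pos.2 ⟨_, this⟩
    simpa using h1
  | succ k ih =>
    have h := card_mul_card_digitSumset_le A k
    have hpos : (0 : ℝ) < (k + 1) ^ m := by positivity
    refine le_of_mul_le_mul_left ?_ hpos
    push_cast
    rw [show (k : ℝ) + 1 + 1 = k + 2 by ring]
    calc ((k : ℝ) + 1) ^ m * ((A.card : ℝ) ^ (k + 1) * (k + 2) ^ m)
        = (A.card * (k + 2) ^ m) * ((A.card : ℝ) ^ k * (k + 1) ^ m) := by ring
      _ ≤ (A.card * (k + 2) ^ m) * ((2 ^ m) ^ k * (digitSumset A k).card) := by gcongr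
      _ = (2 ^ m) ^ k * ((k + 2 : ℝ) ^ m * (A.card * (digitSumset A k).card)) := by ring
      _ ≤ (2 ^ m) ^ k * ((2 * (k + 1)) ^ m * (digitSumset A (k + 1)).card) := by gcongr
      _ = _ := by rw [mul_pow]; ring

/-! ### Digit expansions -/

lemma sum_digit_injective {d n : ℕ} (hn : n ≤ d) : ∀ {m : ℕ},
    Function.Injective fun z : Fin m → Fin n => ∑ i, ((z i : ℕ) : ℤ) * (d : ℤ) ^ (i : ℕ) := by
  intro m
  induction m with
  | zero => exact fun z w _ => Subsingleton.elim z w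
  | succ m ih =>
    intro z w hzw
    have hsucc : ∀ z : Fin (m + 1) → Fin n,
        ∑ i, ((z i : ℕ) : ℤ) * (d : ℤ) ^ (i : ℕ) = ((z 0 : ℕ) : ℤ)
          + d * ∑ i : Fin m, ((z i.succ : ℕ) : ℤ) * (d : ℤ) ^ (i : ℕ) := by
      intro z
      rw [Fin.sum_univ_succ, Finset.mul_sum]
      simp only [Fin.val_zero, pow_zero, mul_one, Fin.val_succ, pow_succ]
      congr 1
      exact Finset.sum_congr rfl fun i _ => by ring
    dsimp only at hzw
    rw [hsucc z, hsucc w] at hzw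
    have hmod : ∀ z : Fin (m + 1) → Fin n, (((z 0 : ℕ) : ℤ)
          + d * ∑ i : Fin m, ((z i.succ : ℕ) : ℤ) * (d : ℤ) ^ (i : ℕ)) % d = (z 0 : ℕ) := by
      intro z
      rw [Int.add_mul_emod_self_left]
      exact Int.emod_eq_of_lt (by positivity) (by exact_mod_cast (z 0).2.trans_le hn)
    have h0 : ((z 0 : ℕ) : ℤ) = (w 0 : ℕ) := by
      rw [← hmod z, ← hmod w, hzw]
    have hd : (d : ℤ) ≠ 0 := by
      have := (z 0).2
      omega
    have htail := ih (a₁ := fun i => z i.succ) (a₂ := fun i => w i.succ)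
      (mul_left_cancel₀ hd (by linarith))
    funext i
    refine Fin.cases ?_ (fun i => ?_) i
    · exact Fin.ext (by exact_mod_cast h0)
    · exact congrFun htail i

lemma linForm_injective {d : ℕ} (hd : 2 ≤ d) {m : ℕ} :
    Function.Injective fun y : Fin m → Fin 2 => linForm d y :=
  sum_digit_injective hd

lemma linForm_cons (d : ℕ) {m : ℕ} (b : Fin 2) (y : Fin m → Fin 2) :
    linForm d (Fin.cons b y : Fin (m + 1) → Fin 2) = ((b : ℕ) : ℤ) + d * linForm d y := by
  rw [linForm, Fin.sum_univ_succ, linForm, Finset.mul_sum]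
  simp only [Fin.cons_zero, Fin.cons_succ, Fin.val_zero, pow_zero, mul_one, Fin.val_succ, pow_succ]
  congr 1
  exact Finset.sum_congr rfl fun i _ => by ring

lemma linForm_nonneg (d : ℕ) {m : ℕ} (y : Fin m → Fin 2) : 0 ≤ linForm d y :=
  Finset.sum_nonneg fun _ _ => by positivity

lemma linForm_lt {d : ℕ} (hd : 2 ≤ d) : ∀ {m : ℕ} (y : Fin m → Fin 2),
    linForm d y < (d : ℤ) ^ m := by
  intro m
  induction m with
  | zero => intro y; simp [linForm]
  | succ m ih =>
    intro y
    rw [← Fin.cons_self_tail y, linForm_cons, pow_succ']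
    have h1 := ih (Fin.tail y)
    have h2 := (y 0).2
    have h3 : (2 : ℤ) ≤ d := by exact_mod_cast hd
    have h4 : (((y 0 : Fin 2) : ℕ) : ℤ) ≤ 1 := by omega
    nlinarith

lemma abs_linForm_add_le {d : ℕ} (hd : 2 ≤ d) {m : ℕ} {t : ℤ} (ht : |t| ≤ (d : ℤ) ^ m)
    (y : Fin m → Fin 2) : |linForm d y + t| ≤ 2 * (d : ℤ) ^ m := by
  have h1 := linForm_lt hd y
  have h2 := linForm_nonneg d y
  rw [abs_le] at *
  constructor <;> linarith

/-- An interval of length `d ^ j` contains `L_d y` for at most `2 ^ j` points `y`: peeling off the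
lowest digit shortens the interval by a factor `d` at the cost of a factor `2`. -/
lemma card_linForm_mem_Ico_le {d : ℕ} (hd : 2 ≤ d) {j m : ℕ} (hj : j ≤ m) (a : ℤ) :
    (Finset.univ.filter fun y : Fin m → Fin 2 =>
      a ≤ linForm d y ∧ linForm d y < a + (d : ℤ) ^ j).card ≤ 2 ^ j := by
  induction j generalizing m a with
  | zero =>
    rw [pow_zero, pow_zero]
    refine Finset.card_le_one.2 fun y hy y' hy' => linForm_injective hd ?_
    rw [Finset.mem_filter] at hy hy'
    show linForm d y = linForm d y'
    omega
  | succ j ih =>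
    obtain ⟨m, rfl⟩ : ∃ n, m = n + 1 := ⟨m - 1, by omega⟩
    rw [Finset.card_filter, sum_fin_succ_pi]
    have hstep : ∀ b : Fin 2, (∑ w : Fin m → Fin 2,
        if a ≤ linForm d (Fin.cons b w : Fin (m + 1) → Fin 2) ∧
          linForm d (Fin.cons b w : Fin (m + 1) → Fin 2) < a + (d : ℤ) ^ (j + 1)
        then 1 else 0) ≤ 2 ^ j := by
      intro b
      rw [← Finset.card_filter]
      refine le_trans (Finset.card_le_card fun w hw => ?_)
        (ih (m := m) (by omega) (-((((b : ℕ) : ℤ) - a) / d)))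
      rw [Finset.mem_filter, linForm_cons] at hw
      rw [Finset.mem_filter]
      obtain ⟨-, h1, h2⟩ := hw
      have hd0 : (0 : ℤ) < d := by exact_mod_cast (by omega : 0 < d)
      have e1 := Int.mul_ediv_add_emod (((b : ℕ) : ℤ) - a) d
      have e2 := Int.emod_nonneg (((b : ℕ) : ℤ) - a) hd0.ne'
      have e3 := Int.emod_lt_of_pos (((b : ℕ) : ℤ) - a) hd0
      set q := (((b : ℕ) : ℤ) - a) / d
      rw [pow_succ'] at h2
      refine ⟨Finset.mem_univ _, ?_, ?_⟩
      · have : (d : ℤ) * (-q - 1) < d * linForm d w := by linarith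
        have := lt_of_mul_lt_mul_left this hd0.le
        omega
      · refine lt_of_mul_lt_mul_left (a := (d : ℤ)) ?_ hd0.le
        linarith
    rw [Fin.sum_univ_two, pow_succ 2, mul_two]
    exact Nat.add_le_add (hstep 0) (hstep 1)

/-- Pigeonhole on the `m - k` highest digits, carried out by peeling off one low digit at a time. -/
lemma exists_ne_abs_linForm_sub_lt {d : ℕ} (hd : 2 ≤ d) {k m : ℕ} (hk : k ≤ m)
    (G : Finset (Fin m → Fin 2)) (hG : 2 ^ (m - k) < G.card) :
    ∃ y ∈ G, ∃ y' ∈ G, y ≠ y' ∧ |linForm d y - linForm d y'| < (d : ℤ) ^ k := by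
  classical
  induction k generalizing m with
  | zero =>
    have := Finset.card_le_univ G
    simp at this hG
    omega
  | succ k ih =>
    obtain ⟨m, rfl⟩ : ∃ n, m = n + 1 := ⟨m - 1, by omega⟩
    have hd' : (2 : ℤ) ≤ d := by exact_mod_cast hd
    have hlin : ∀ y : Fin (m + 1) → Fin 2,
        linForm d y = ((y 0 : ℕ) : ℤ) + d * linForm d (Fin.tail y) := fun y => by
      rw [← linForm_cons, Fin.cons_self_tail]
    have hdig : ∀ y y' : Fin (m + 1) → Fin 2, |((y 0 : ℕ) : ℤ) - (y' 0 : ℕ)| ≤ 1 := by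
      intro y y'
      have := (y 0).2
      have := (y' 0).2
      rw [abs_le]
      omega
    by_cases hinj : Set.InjOn (Fin.tail : (Fin (m + 1) → Fin 2) → (Fin m → Fin 2)) G
    · obtain ⟨u, hu, u', hu', hne, hlt⟩ := ih (m := m) (by omega) (G.image Fin.tail) (by
        rw [Finset.card_image_of_injOn hinj]
        simpa using hG)
      obtain ⟨y, hy, rfl⟩ := Finset.mem_image.1 hu
      obtain ⟨y', hy', rfl⟩ := Finset.mem_image.1 hu'
      refine ⟨y, hy, y', hy', fun h => hne (by rw [h]), ?_⟩
      have h1 := hdig y y'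
      rw [hlin y, hlin y', pow_succ']
      rw [abs_le] at h1
      rw [abs_lt] at hlt ⊢
      constructor <;> nlinarith
    · rw [Set.InjOn] at hinj
      push Not at hinj
      obtain ⟨y, hy, y', hy', htail, hne⟩ := hinj
      refine ⟨y, hy, y', hy', hne, ?_⟩
      rw [hlin y, hlin y', htail, add_sub_add_right_eq_sub]
      refine (hdig y y').trans_lt ?_
      have : (1 : ℤ) ≤ (d : ℤ) ^ k := one_le_pow₀ (by linarith)
      rw [pow_succ]
      nlinarith

/-- Two values of `L_d + t` on a dense set that are close together, the second one being large. -/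
lemma exists_close_pair {d : ℕ} (hd : 2 ≤ d) {k m : ℕ} (hk : k ≤ m)
    (G : Finset (Fin m → Fin 2)) (hG : 2 * 2 ^ (m - k) < G.card) (t : ℤ) :
    ∃ y ∈ G, ∃ y' ∈ G, linForm d y ≠ linForm d y' ∧
      |linForm d y - linForm d y'| < (d : ℤ) ^ k ∧
      (d : ℤ) ^ (m - k) ≤ 2 * |linForm d y' + t| := by
  classical
  -- Remove from `G` the points where `L_d + t` lies in an interval of length `d ^ (m - k)`
  -- centred at `0`.
  set a : ℤ := -t - (d : ℤ) ^ (m - k) / 2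
  set B := Finset.univ.filter fun y : Fin m → Fin 2 =>
    a ≤ linForm d y ∧ linForm d y < a + (d : ℤ) ^ (m - k) with hB
  have hBcard : B.card ≤ 2 ^ (m - k) := card_linForm_mem_Ico_le hd (Nat.sub_le _ _) a
  obtain ⟨y, hy, y', hy', hne, hlt⟩ := exists_ne_abs_linForm_sub_lt hd hk (G \ B) (by
    have := Finset.le_card_sdiff B G
    omega)
  rw [Finset.mem_sdiff] at hy hy'
  refine ⟨y, hy.1, y', hy'.1, fun h => hne (linForm_injective hd h), hlt, ?_⟩
  have hnot : ¬ (a ≤ linForm d y' ∧ linForm d y' < a + (d : ℤ) ^ (m - k)) := by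
    simpa [hB] using hy'.2
  by_cases h1 : a ≤ linForm d y'
  · have h2 : a + (d : ℤ) ^ (m - k) ≤ linForm d y' := not_lt.1 fun h => hnot ⟨h1, h⟩
    have := le_abs_self (linForm d y' + t)
    omega
  · have := neg_le_abs (linForm d y' + t)
    omega

/-! ### Counting sums `x₁ z₁ + x₂ z₂` -/

lemma card_le_of_dvd_sub {T : Finset ℤ} {B q : ℕ} (hq : 0 < q) (hB : ∀ x ∈ T, |x| ≤ B)
    (hdvd : ∀ x ∈ T, ∀ y ∈ T, (q : ℤ) ∣ x - y) : T.card ≤ 2 * B / q + 1 := by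
  have hq' : (0 : ℤ) < q := by exact_mod_cast hq
  have := Finset.card_le_card_of_injOn (s := T) (t := Finset.Icc (0 : ℤ) ((2 * B : ℤ) / q))
    (fun x => (x + B) / q)
    (fun x hx => by
      have := abs_le.1 (hB x hx)
      exact Finset.mem_coe.2 (Finset.mem_Icc.2 ⟨Int.ediv_nonneg (by linarith) hq'.le,
        Int.ediv_le_ediv hq' (by linarith)⟩))
    (fun x hx y hy hxy => by
      dsimp only at hxy
      have e1 := Int.mul_ediv_add_emod (x + B) q
      have e2 := Int.mul_ediv_add_emod (y + B) q
      have e3 : (x + B) % (q : ℤ) = (y + B) % q :=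
        Int.emod_eq_emod_iff_emod_sub_eq_zero.2
          (Int.emod_eq_zero_of_dvd (by simpa using hdvd x hx y hy))
      rw [hxy] at e1
      linarith)
  rw [Int.card_Icc] at this
  refine this.trans ?_
  have : ((2 * B / q : ℕ) : ℤ) = (2 * B : ℤ) / q := by push_cast; rfl
  rw [← this, sub_zero]
  exact le_rfl

/-- If `gcd(z₁, z₂)` is at most `D`, then `x₁ z₁ + x₂ z₂ = n` confines `x₁` to a residue class modulo
`z₂ / gcd(z₁, z₂)`, so that few pairs `(x₁, x₂)` share the same sum. -/
theorem card_mul_card_mul_le {X₁ X₂ S : Finset ℤ} {B D : ℕ} {z₁ z₂ : ℤ} (hz : z₂ ≠ 0)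
    (hD : Int.gcd z₁ z₂ ≤ D) (hB : ∀ x ∈ X₁, |x| ≤ B)
    (hS : ∀ x₁ ∈ X₁, ∀ x₂ ∈ X₂, x₁ * z₁ + x₂ * z₂ ∈ S) :
    X₁.card * X₂.card * z₂.natAbs ≤ (2 * B * D + z₂.natAbs) * S.card := by
  classical
  have hg : 0 < Int.gcd z₁ z₂ := Int.gcd_pos_of_ne_zero_right _ hz
  obtain ⟨p, q, hpq, hp, hq⟩ := Int.exists_gcd_one hg
  set g := Int.gcd z₁ z₂
  have hq0 : 0 < q.natAbs := by
    refine Int.natAbs_pos.2 fun h => hz ?_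
    rw [hq, h, zero_mul]
  have hfib : ∀ n ∈ (X₁ ×ˢ X₂).image (fun x => x.1 * z₁ + x.2 * z₂),
      ((X₁ ×ˢ X₂).filter fun x => x.1 * z₁ + x.2 * z₂ = n).card ≤ 2 * B / q.natAbs + 1 := by
    intro n _
    rw [← Finset.card_image_of_injOn (f := Prod.fst)]
    · refine card_le_of_dvd_sub hq0 (fun x hx => ?_) fun x hx y hy => ?_
      · obtain ⟨u, hu, rfl⟩ := Finset.mem_image.1 hx
        exact hB _ (Finset.mem_product.1 (Finset.mem_filter.1 hu).1).1
      · obtain ⟨u, hu, rfl⟩ := Finset.mem_image.1 hx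
        obtain ⟨v, hv, rfl⟩ := Finset.mem_image.1 hy
        have hu := (Finset.mem_filter.1 hu).2
        have hv := (Finset.mem_filter.1 hv).2
        rw [Int.natAbs_dvd]
        have hcop : IsCoprime q p := (Int.isCoprime_iff_gcd_eq_one.2 hpq).symm
        refine hcop.dvd_of_dvd_mul_right ⟨v.2 - u.2, ?_⟩
        have hg' : (g : ℤ) ≠ 0 := by exact_mod_cast hg.ne'
        refine mul_right_cancel₀ hg' ?_
        rw [hp, hq] at hu hv
        linear_combination hu - hv
    · intro u hu v hv huv
      have hu := (Finset.mem_filter.1 (Finset.mem_coe.1 hu)).2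
      have hv := (Finset.mem_filter.1 (Finset.mem_coe.1 hv)).2
      refine Prod.ext huv (mul_right_cancel₀ hz ?_)
      have huv' : u.1 = v.1 := huv
      rw [huv'] at hu
      linarith
  have hcard := Finset.card_le_mul_card_image _ _ hfib
  rw [Finset.card_product] at hcard
  have hsub : ((X₁ ×ˢ X₂).image (fun x => x.1 * z₁ + x.2 * z₂)).card ≤ S.card := by
    refine Finset.card_le_card fun n hn => ?_
    obtain ⟨u, hu, rfl⟩ := Finset.mem_image.1 hn
    exact hS _ (Finset.mem_product.1 hu).1 _ (Finset.mem_product.1 hu).2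
  have hz2 : z₂.natAbs = q.natAbs * g := by
    rw [hq, Int.natAbs_mul, Int.natAbs_natCast]
  have hdiv : (2 * B / q.natAbs + 1) * z₂.natAbs ≤ 2 * B * D + z₂.natAbs := by
    rw [add_mul, one_mul]
    refine Nat.add_le_add_right ?_ _
    calc 2 * B / q.natAbs * z₂.natAbs = (2 * B / q.natAbs * q.natAbs) * g := by rw [hz2]; ring
      _ ≤ 2 * B * D := Nat.mul_le_mul (Nat.div_mul_le_self _ _) hD
  calc X₁.card * X₂.card * z₂.natAbs
      ≤ (2 * B / q.natAbs + 1) * S.card * z₂.natAbs :=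
        Nat.mul_le_mul_right _ (hcard.trans (Nat.mul_le_mul_left _ hsub))
    _ = (2 * B / q.natAbs + 1) * z₂.natAbs * S.card := by ring
    _ ≤ _ := Nat.mul_le_mul_right _ hdiv

/-! ### Signed sums of products -/

lemma IsSignedSumOfAtMost.mono {s s' : ℕ} (h : s ≤ s') {S : Set ℤ} {x : ℤ}
    (hx : IsSignedSumOfAtMost s S x) : IsSignedSumOfAtMost s' S x := by
  obtain ⟨k, hk, ε, a, ha, hx⟩ := hx
  exact ⟨k, hk.trans h, ε, a, ha, hx⟩

lemma IsSignedSumOfAtMost.add {s s' : ℕ} {S : Set ℤ} {x y : ℤ}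
    (hx : IsSignedSumOfAtMost s S x) (hy : IsSignedSumOfAtMost s' S y) :
    IsSignedSumOfAtMost (s + s') S (x + y) := by
  obtain ⟨k, hk, ε, a, ha, rfl⟩ := hx
  obtain ⟨k', hk', ε', a', ha', rfl⟩ := hy
  refine ⟨k + k', Nat.add_le_add hk hk', Fin.append ε ε', Fin.append a a', fun i => ?_, ?_⟩
  · refine Fin.addCases (fun i => ?_) (fun i => ?_) i
    · simpa using ha i
    · simpa using ha' i
  · simp [Fin.sum_univ_add]

lemma IsSignedSumOfAtMost.mul_right {s : ℕ} {S S' : Set ℤ} {x z : ℤ}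
    (hx : IsSignedSumOfAtMost s S x) (hS : ∀ a ∈ S, a * z ∈ S') :
    IsSignedSumOfAtMost s S' (x * z) := by
  obtain ⟨k, hk, ε, a, ha, rfl⟩ := hx
  refine ⟨k, hk, ε, fun i => a i * z, fun i => hS _ (ha i), ?_⟩
  rw [Finset.sum_mul]
  exact Finset.sum_congr rfl fun i _ => mul_assoc _ _ _

/-- The integers `x` with `|x| ≤ (8dN)^r`, where `N = d ^ m`, that are signed sums of at most
`(4d)^r` products `∏_j (L_d(y_j) + t_j)` with `(y_1, …, y_r) ∈ A`. -/
def boundedSums (d : ℕ) {r m : ℕ} (t : Fin r → ℤ) (A : Finset (Fin r → Fin m → Fin 2)) : Set ℤ :=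
  {x : ℤ | |x| ≤ ((8 * d * d ^ m : ℕ) : ℤ) ^ r ∧
    IsSignedSumOfAtMost ((4 * d) ^ r) (shiftedProducts d t A) x}

lemma finite_boundedSums (d : ℕ) {r m : ℕ} (t : Fin r → ℤ) (A : Finset (Fin r → Fin m → Fin 2)) :
    (boundedSums d t A).Finite :=
  (Set.finite_Icc (-((8 * d * d ^ m : ℕ) : ℤ) ^ r) (((8 * d * d ^ m : ℕ) : ℤ) ^ r)).subset
    fun _ hx => abs_le.1 hx.1

/-- The fibre of `A` over a value `y` of the first coordinate. -/
def fibre {r m : ℕ} (A : Finset (Fin (r + 1) → Fin m → Fin 2)) (y : Fin m → Fin 2) :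
    Finset (Fin r → Fin m → Fin 2) :=
  Finset.univ.filter fun w => (Fin.cons y w : Fin (r + 1) → Fin m → Fin 2) ∈ A

lemma card_eq_sum_card_fibre {r m : ℕ} (A : Finset (Fin (r + 1) → Fin m → Fin 2)) :
    A.card = ∑ y, (fibre A y).card := by
  have h1 : A.card = ∑ z : Fin (r + 1) → Fin m → Fin 2, if z ∈ A then 1 else 0 := by
    rw [← Finset.card_filter]; simp
  rw [h1]
  simp only [fibre, Finset.card_filter]
  rw [← Fintype.sum_prod_type']
  exact (Fintype.sum_equiv (Fin.consEquiv fun _ : Fin (r + 1) => Fin m → Fin 2) _ _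
    fun _ => rfl).symm

/-- A set of density `α` has at least a proportion `α / 2` of fibres of density `α / 2`. -/
lemma card_dense_fibres {r m : ℕ} (A : Finset (Fin (r + 1) → Fin m → Fin 2)) {α : ℝ}
    (hα : 0 ≤ α) (hA : α * (2 : ℝ) ^ (m * (r + 1)) ≤ (A.card : ℝ)) :
    α / 2 * 2 ^ m ≤ ((Finset.univ.filter fun y : Fin m → Fin 2 =>
      α / 2 * (2 : ℝ) ^ (m * r) ≤ ((fibre A y).card : ℝ)).card : ℝ) := by
  classical
  set G := Finset.univ.filter fun y : Fin m → Fin 2 =>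
    α / 2 * (2 : ℝ) ^ (m * r) ≤ ((fibre A y).card : ℝ) with hG
  have hle : ∀ y, ((fibre A y).card : ℝ) ≤
      (if y ∈ G then (2 : ℝ) ^ (m * r) else 0) + α / 2 * 2 ^ (m * r) := by
    intro y
    split_ifs with hy
    · have h : (fibre A y).card ≤ 2 ^ (m * r) := by
        simpa [← pow_mul] using Finset.card_le_univ (fibre A y)
      have h' : ((fibre A y).card : ℝ) ≤ 2 ^ (m * r) := by exact_mod_cast h
      have : 0 ≤ α / 2 * (2 : ℝ) ^ (m * r) := by positivity
      linarith
    · have : ¬ α / 2 * (2 : ℝ) ^ (m * r) ≤ ((fibre A y).card : ℝ) := by simpa [hG] using hy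
      linarith
  have hsum : (A.card : ℝ) ≤ G.card * 2 ^ (m * r) + 2 ^ m * (α / 2 * 2 ^ (m * r)) := by
    rw [card_eq_sum_card_fibre, Nat.cast_sum]
    refine (Finset.sum_le_sum fun y _ => hle y).trans (le_of_eq ?_)
    rw [Finset.sum_add_distrib]
    simp
  have hpos : (0 : ℝ) < 2 ^ (m * r) := by positivity
  refine le_of_mul_le_mul_right ?_ hpos
  have hpow : (2 : ℝ) ^ (m * (r + 1)) = 2 ^ m * 2 ^ (m * r) := by
    rw [mul_add, mul_one, pow_add, mul_comm]
  rw [hpow] at hA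
  linarith

lemma add_mem_boundedSums {d : ℕ} (hd : 2 ≤ d) {r m : ℕ} {t : Fin (r + 1) → ℤ}
    (ht : |t 0| ≤ (d : ℤ) ^ m) {A : Finset (Fin (r + 1) → Fin m → Fin 2)}
    {y₁ y₂ : Fin m → Fin 2} {x₁ x₂ : ℤ}
    (hx₁ : x₁ ∈ boundedSums d (fun j => t j.succ) (fibre A y₁))
    (hx₂ : x₂ ∈ boundedSums d (fun j => t j.succ) (fibre A y₂)) :
    x₁ * (linForm d y₁ + t 0) + x₂ * (linForm d y₂ + t 0) ∈ boundedSums d t A := by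
  have hprod : ∀ y, ∀ a ∈ shiftedProducts d (fun j => t j.succ) (fibre A y),
      a * (linForm d y + t 0) ∈ shiftedProducts d t A := by
    rintro y a ⟨w, hw, rfl⟩
    refine ⟨Fin.cons y w, (Finset.mem_filter.1 hw).2, ?_⟩
    rw [Fin.prod_univ_succ, mul_comm]
    simp
  refine ⟨?_, ((hx₁.2.mul_right (hprod y₁)).add (hx₂.2.mul_right (hprod y₂))).mono ?_⟩
  · have hz : ∀ y, |linForm d y + t 0| ≤ 2 * (d : ℤ) ^ m := abs_linForm_add_le hd ht
    have hd' : (2 : ℤ) ≤ d := by exact_mod_cast hd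
    have hN : (0 : ℤ) ≤ (d : ℤ) ^ m := by positivity
    have hX : (0 : ℤ) ≤ ((8 * d * d ^ m : ℕ) : ℤ) ^ r := by positivity
    calc |x₁ * (linForm d y₁ + t 0) + x₂ * (linForm d y₂ + t 0)|
        ≤ |x₁| * |linForm d y₁ + t 0| + |x₂| * |linForm d y₂ + t 0| := by
          rw [← abs_mul, ← abs_mul]; exact abs_add_le _ _
      _ ≤ ((8 * d * d ^ m : ℕ) : ℤ) ^ r * (2 * (d : ℤ) ^ m)
          + ((8 * d * d ^ m : ℕ) : ℤ) ^ r * (2 * (d : ℤ) ^ m) := by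
          gcongr
          exacts [hx₁.1, hz y₁, hx₂.1, hz y₂]
      _ = ((8 * d * d ^ m : ℕ) : ℤ) ^ r * (4 * (d : ℤ) ^ m) := by ring
      _ ≤ ((8 * d * d ^ m : ℕ) : ℤ) ^ r * ((8 * d * d ^ m : ℕ) : ℤ) := by
          refine mul_le_mul_of_nonneg_left ?_ hX
          push_cast
          exact mul_le_mul_of_nonneg_right (by linarith) hN
      _ = _ := (pow_succ _ _).symm
  · rw [pow_succ]
    have : 0 < (4 * d) ^ r := by positivity
    nlinarith

/-! ### The induction on the number of factors -/

/-- For a single factor, the `(d - 1)`-fold sums have digits at most `d - 1`, on which `L_d` is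
injective, so the density of the sumset in the digit cube carries over to the integers. -/
lemma boundedSums_one {d m : ℕ} (hd : 2 ≤ d) {α : ℝ} (hα0 : 0 < α) (hα1 : α ≤ 1)
    (t : Fin 1 → ℤ) (ht : ∀ j, |t j| ≤ (d : ℤ) ^ m) (A : Finset (Fin 1 → Fin m → Fin 2))
    (hA : α * (2 : ℝ) ^ (m * 1) ≤ (A.card : ℝ)) :
    (α / 2) ^ ((32 * d) ^ 1) * ((d ^ m : ℕ) : ℝ) ^ 1 ≤ ((boundedSums d t A).ncard : ℝ) := by
  classical
  obtain ⟨k, rfl⟩ : ∃ k, d = k + 1 := ⟨d - 1, by omega⟩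
  set A' : Finset (Fin m → Fin 2) := A.image fun y => y 0 with hA'
  have hA'card : A'.card = A.card := Finset.card_image_of_injective _ fun y y' h =>
    funext fun i => by rw [Subsingleton.elim i 0]; exact h
  have hmaps : ∀ z ∈ digitSumset A' k,
      ∑ i, ((z i : ℕ) : ℤ) * ((k + 1 : ℕ) : ℤ) ^ (i : ℕ) + k * t 0 ∈
        boundedSums (k + 1) t A := by
    intro z hz
    obtain ⟨a, ha, hza⟩ := mem_digitSumset.1 hz
    have hsum : ∑ i, ((z i : ℕ) : ℤ) * ((k + 1 : ℕ) : ℤ) ^ (i : ℕ) + k * t 0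
        = ∑ j, (linForm (k + 1) (a j) + t 0) := by
      rw [Finset.sum_add_distrib]
      simp only [linForm, hza, Nat.cast_sum, Finset.sum_mul, Finset.sum_const, Finset.card_univ,
        Fintype.card_fin, nsmul_eq_mul]
      rw [Finset.sum_comm]
    rw [hsum]
    refine ⟨?_, k, by rw [pow_one]; omega, fun _ => 1, fun j => linForm (k + 1) (a j) + t 0,
      fun j => ?_, by simp⟩
    · calc |∑ j, (linForm (k + 1) (a j) + t 0)|
          ≤ ∑ j, |linForm (k + 1) (a j) + t 0| := Finset.abs_sum_le_sum_abs _ _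
        _ ≤ ∑ _j : Fin k, 2 * ((k + 1 : ℕ) : ℤ) ^ m :=
            Finset.sum_le_sum fun j _ => abs_linForm_add_le hd (ht 0) _
        _ = (k * 2) * ((k + 1 : ℕ) : ℤ) ^ m := by simp [mul_assoc]
        _ ≤ (8 * (k + 1 : ℕ)) * ((k + 1 : ℕ) : ℤ) ^ m := by
            refine mul_le_mul_of_nonneg_right ?_ (by positivity)
            push_cast
            linarith
        _ = _ := by push_cast; ring
    · obtain ⟨y, hy, hya⟩ := Finset.mem_image.1 (ha j)
      exact ⟨y, hy, by simp [← hya]⟩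
  have hcard : (digitSumset A' k).card ≤ (boundedSums (k + 1) t A).ncard := by
    rw [← Set.ncard_coe_finset]
    refine Set.ncard_le_ncard_of_injOn _ hmaps (fun z _ w _ h => ?_) (finite_boundedSums _ _ _)
    exact sum_digit_injective le_rfl (add_right_cancel h)
  have hmain := card_pow_mul_le_card_digitSumset A' k
  rw [hA'card] at hmain
  rw [mul_one] at hA
  have hpos : (0 : ℝ) < (2 ^ m) ^ k := by positivity
  have h1 : α ^ k * (k + 1) ^ m ≤ (digitSumset A' k).card := by
    refine le_of_mul_le_mul_left ?_ hpos
    calc (2 ^ m) ^ k * (α ^ k * (k + 1 : ℝ) ^ m) = (α * 2 ^ m) ^ k * (k + 1) ^ m := by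
          rw [mul_pow]; ring
      _ ≤ (A.card : ℝ) ^ k * (k + 1) ^ m := by gcongr
      _ ≤ _ := hmain
  have h2 : (α / 2) ^ ((32 * (k + 1)) ^ 1) ≤ α ^ k :=
    calc (α / 2) ^ ((32 * (k + 1)) ^ 1) ≤ α ^ ((32 * (k + 1)) ^ 1) := by
          gcongr; linarith
      _ ≤ α ^ k := pow_le_pow_of_le_one hα0.le hα1 (by rw [pow_one]; omega)
  calc (α / 2) ^ ((32 * (k + 1)) ^ 1) * (((k + 1) ^ m : ℕ) : ℝ) ^ 1
      ≤ α ^ k * (k + 1) ^ m := by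
        rw [pow_one (((k + 1) ^ m : ℕ) : ℝ)]
        push_cast
        exact mul_le_mul_of_nonneg_right h2 (by positivity)
    _ ≤ (digitSumset A' k).card := h1
    _ ≤ _ := by exact_mod_cast hcard

lemma exists_pow_two_near {α : ℝ} (hα0 : 0 < α) (hα1 : α ≤ 1) :
    ∃ k : ℕ, 4 / α < 2 ^ k ∧ (2 : ℝ) ^ k ≤ (2 / α) ^ 3 := by
  have h1 : 1 ≤ 4 / α := by rw [le_div_iff₀ hα0]; linarith
  obtain ⟨n, hn, hn'⟩ := exists_nat_pow_near h1 (one_lt_two (α := ℝ))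
  refine ⟨n + 1, hn', ?_⟩
  have h2 : 2 ≤ 2 / α := by rw [le_div_iff₀ hα0]; linarith
  rw [pow_succ]
  have h3 : 4 / α = 2 * (2 / α) := by ring
  calc (2 : ℝ) ^ n * 2 ≤ 2 * 2 * (2 / α) := by linarith
    _ ≤ 2 / α * (2 / α) * (2 / α) := by gcongr
    _ = _ := by ring

/-- The losses of one inductive step, in terms of `β = 2 / α`, `E = (32d)^r` and `D = d ^ k`, are
absorbed by raising the exponent from `E` to `32 d E`. -/
lemma step_constants_le {d r : ℕ} (hd : 2 ≤ d) (hr : 1 ≤ r) {β D : ℝ} (hβ : 2 ≤ β) (hD0 : 0 ≤ D)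
    (hD : D ≤ β ^ (3 * d)) :
    ((2 * β) ^ ((32 * d) ^ r)) ^ 2 * (6 * (8 * d) ^ r * D ^ 2) ≤ β ^ ((32 * d) ^ (r + 1)) := by
  set E := (32 * d) ^ r with hE
  have hβ1 : 1 ≤ β := by linarith
  have hdE : d ≤ E :=
    calc d ≤ 32 * d := by omega
      _ = (32 * d) ^ 1 := (pow_one _).symm
      _ ≤ E := Nat.pow_le_pow_right (by omega) hr
  have h1 : ((2 * β) ^ E) ^ 2 ≤ β ^ (4 * E) :=
    calc ((2 * β) ^ E) ^ 2 ≤ ((β * β) ^ E) ^ 2 := by gcongr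
      _ = _ := by rw [← pow_two, ← pow_mul, ← pow_mul]; congr 1; ring
  have h2 : (6 * (8 * d) ^ r : ℝ) ≤ β ^ (2 * E) := by
    have h4 : 4 * (8 * d) ^ r ≤ E := by
      rw [hE, show 32 * d = 4 * (8 * d) by ring, mul_pow 4]
      exact Nat.mul_le_mul_right _ (by simpa using Nat.pow_le_pow_right (n := 4) (by norm_num) hr)
    have h5 : E ≤ 2 ^ E := Nat.lt_two_pow_self.le
    have h6 : 6 * (8 * d) ^ r ≤ 2 ^ (2 * E) := by
      have h7 : 2 ≤ 2 ^ E := by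
        simpa using Nat.pow_le_pow_right (n := 2) (by norm_num) (show 1 ≤ E by omega)
      rw [two_mul, pow_add]
      nlinarith
    calc (6 * (8 * d) ^ r : ℝ) ≤ 2 ^ (2 * E) := by exact_mod_cast h6
      _ ≤ _ := by gcongr
  have h3 : D ^ 2 ≤ β ^ (6 * E) :=
    calc D ^ 2 ≤ (β ^ (3 * d)) ^ 2 := by gcongr
      _ = β ^ (6 * d) := by rw [← pow_mul]; congr 1; ring
      _ ≤ _ := pow_le_pow_right₀ hβ1 (by omega)
  calc _ ≤ β ^ (4 * E) * (β ^ (2 * E) * β ^ (6 * E)) := by gcongr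
    _ = β ^ (12 * E) := by rw [← pow_add, ← pow_add]; congr 1; ring
    _ ≤ _ := pow_le_pow_right₀ hβ1 (by rw [pow_succ, ← hE]; nlinarith)

/-- The step from `r` to `r + 1` factors: two dense fibres `A_{y₁}`, `A_{y₂}`, with
`z_i = L_d(y_i) + t_0` close together and `z₂` large, already provide enough sums
`x₁ z₁ + x₂ z₂`. -/
lemma boundedSums_succ {d m r : ℕ} (hd : 2 ≤ d) (hr : 1 ≤ r)
    (ih : ∀ (α : ℝ), 0 < α → α ≤ 1 → (2 / α) ^ ((32 * d) ^ r) ≤ ((d ^ m : ℕ) : ℝ) →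
      ∀ t : Fin r → ℤ, (∀ j, |t j| ≤ (d : ℤ) ^ m) → ∀ A : Finset (Fin r → Fin m → Fin 2),
        α * (2 : ℝ) ^ (m * r) ≤ (A.card : ℝ) →
        (α / 2) ^ ((32 * d) ^ r) * ((d ^ m : ℕ) : ℝ) ^ r ≤ ((boundedSums d t A).ncard : ℝ))
    {α : ℝ} (hα0 : 0 < α) (hα1 : α ≤ 1)
    (hN : (2 / α) ^ ((32 * d) ^ (r + 1)) ≤ ((d ^ m : ℕ) : ℝ))
    (t : Fin (r + 1) → ℤ) (ht : ∀ j, |t j| ≤ (d : ℤ) ^ m)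
    (A : Finset (Fin (r + 1) → Fin m → Fin 2))
    (hA : α * (2 : ℝ) ^ (m * (r + 1)) ≤ (A.card : ℝ)) :
    (α / 2) ^ ((32 * d) ^ (r + 1)) * ((d ^ m : ℕ) : ℝ) ^ (r + 1) ≤
      ((boundedSums d t A).ncard : ℝ) := by
  classical
  have hβ : 2 ≤ 2 / α := by rw [le_div_iff₀ hα0]; linarith
  set E := (32 * d) ^ r with hE
  have hE1 : 1 ≤ E := Nat.one_le_pow _ _ (by omega)
  -- The number `k` of digits in which the two first coordinates are allowed to differ.
  obtain ⟨k, hk, hk'⟩ := exists_pow_two_near hα0 hα1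
  have hD : (d : ℝ) ^ k ≤ (2 / α) ^ (3 * d) :=
    calc (d : ℝ) ^ k ≤ (2 ^ d) ^ k := by gcongr; exact_mod_cast Nat.lt_two_pow_self.le
      _ = (2 ^ k) ^ d := by rw [← pow_mul, ← pow_mul, mul_comm]
      _ ≤ ((2 / α) ^ 3) ^ d := by gcongr
      _ = _ := by rw [← pow_mul]
  have hkm : k ≤ m := by
    have h : (d : ℝ) ^ k ≤ ((d ^ m : ℕ) : ℝ) := hD.trans <| hN.trans' <|
      pow_le_pow_right₀ (by linarith) (by rw [pow_succ, ← hE]; nlinarith)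
    exact (Nat.pow_le_pow_iff_right (by omega : 1 < d)).1 (by exact_mod_cast h)
  set G := Finset.univ.filter fun y : Fin m → Fin 2 =>
    α / 2 * (2 : ℝ) ^ (m * r) ≤ ((fibre A y).card : ℝ) with hG
  have hGcard : α / 2 * 2 ^ m ≤ (G.card : ℝ) := card_dense_fibres A hα0.le hA
  have hGcard' : 2 * 2 ^ (m - k) < G.card := by
    have h : (2 * 2 ^ (m - k) : ℝ) < G.card := by
      refine lt_of_lt_of_le ?_ hGcard
      have e : (2 : ℝ) ^ m = 2 ^ k * 2 ^ (m - k) := by rw [← pow_add]; congr 1; omega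
      rw [e, ← mul_assoc]
      gcongr
      rw [div_lt_iff₀ hα0] at hk
      linarith
    exact_mod_cast h
  obtain ⟨y₁, hy₁, y₂, hy₂, hne, hclose, hlarge⟩ := exists_close_pair hd hkm G hGcard' (t 0)
  set z₁ := linForm d y₁ + t 0
  set z₂ := linForm d y₂ + t 0
  have hd0 : 0 < d := by omega
  have hz₂ : z₂ ≠ 0 := by
    intro h
    rw [h, abs_zero, mul_zero] at hlarge
    have : (0 : ℤ) < (d : ℤ) ^ (m - k) := by positivity
    omega
  -- The gcd of `z₁` and `z₂` divides their nonzero difference.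
  have hgcd : Int.gcd z₁ z₂ ≤ d ^ k := by
    have h1 : (Int.gcd z₁ z₂ : ℤ) ∣ linForm d y₁ - linForm d y₂ := by
      have := dvd_sub (Int.gcd_dvd_left z₁ z₂) (Int.gcd_dvd_right z₁ z₂)
      rwa [show z₁ - z₂ = linForm d y₁ - linForm d y₂ from add_sub_add_right_eq_sub _ _ _] at this
    have h2 := Int.le_of_dvd (abs_pos.2 (sub_ne_zero.2 hne)) ((dvd_abs _ _).2 h1)
    exact_mod_cast h2.trans hclose.le
  have hfin : ∀ y, (boundedSums d (fun j => t j.succ) (fibre A y)).Finite :=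
    fun _ => finite_boundedSums _ _ _
  set N : ℝ := ((d ^ m : ℕ) : ℝ) with hNdef
  have hN1 : 1 ≤ N := by rw [hNdef]; exact_mod_cast Nat.one_le_pow _ _ hd0
  have hX : ∀ y ∈ G, (α / 2 / 2) ^ E * N ^ r ≤ ((hfin y).toFinset.card : ℝ) := by
    intro y hy
    rw [← Set.ncard_eq_toFinset_card _ (hfin y)]
    refine ih (α / 2) (by linarith) (by linarith) ?_ _ (fun j => ht _) _ (Finset.mem_filter.1 hy).2
    refine le_trans ?_ hN
    calc (2 / (α / 2)) ^ E = (2 * (2 / α)) ^ E := by congr 1; field_simp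
      _ ≤ ((2 / α) * (2 / α)) ^ E := by gcongr
      _ = (2 / α) ^ (2 * E) := by rw [← pow_two, ← pow_mul]
      _ ≤ _ := pow_le_pow_right₀ (by linarith) (by rw [pow_succ, ← hE]; nlinarith)
  have hcount := card_mul_card_mul_le (X₁ := (hfin y₁).toFinset) (X₂ := (hfin y₂).toFinset)
    (S := (finite_boundedSums d t A).toFinset) (B := (8 * d * d ^ m) ^ r) hz₂ hgcd
    (fun x hx => by
      have := ((hfin y₁).mem_toFinset.1 hx).1
      exact_mod_cast this)
    (fun x₁ hx₁ x₂ hx₂ => (Set.Finite.mem_toFinset _).2 <| add_mem_boundedSums hd (ht 0)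
      ((hfin y₁).mem_toFinset.1 hx₁) ((hfin y₂).mem_toFinset.1 hx₂))
  rw [← Set.ncard_eq_toFinset_card _ (finite_boundedSums d t A)] at hcount
  set M := (boundedSums d t A).ncard
  set a := (hfin y₁).toFinset.card
  set b := (hfin y₂).toFinset.card
  set D : ℝ := (d : ℝ) ^ k with hDdef
  have hD1 : 1 ≤ D := one_le_pow₀ (by exact_mod_cast hd0)
  set Z : ℝ := (z₂.natAbs : ℝ) with hZ
  have hcount' : (a : ℝ) * b * Z ≤ (2 * (8 * d * N) ^ r * D + Z) * M := by
    have := (Nat.cast_le (α := ℝ)).2 hcount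
    push_cast at this
    simpa [hNdef, hDdef, hZ] using this
  have hZlow : N ≤ 2 * Z * D := by
    have h1 : d ^ (m - k) ≤ 2 * z₂.natAbs := by
      have : ((d ^ (m - k) : ℕ) : ℤ) ≤ ((2 * z₂.natAbs : ℕ) : ℤ) := by
        push_cast
        exact hlarge
      exact_mod_cast this
    have h2 : (d : ℝ) ^ (m - k) ≤ 2 * Z := by rw [hZ]; exact_mod_cast h1
    calc N = (d : ℝ) ^ (m - k) * D := by
          rw [hNdef, hDdef, ← pow_add]; push_cast; congr 1; omega
      _ ≤ _ := by gcongr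
  have hB : 8 * d * N ≤ (8 * d * N) ^ r := le_self_pow₀ (by
    have : (1 : ℝ) ≤ d := by exact_mod_cast hd0
    nlinarith) (by omega)
  have hZup : Z ≤ (8 * d * N) ^ r * D := by
    have h1 : (z₂.natAbs : ℤ) ≤ 2 * (d : ℤ) ^ m := by
      rw [Int.natCast_natAbs]
      exact abs_linForm_add_le hd (ht 0) y₂
    have h2 : Z ≤ 2 * N := by rw [hZ, hNdef]; exact_mod_cast h1
    have h3 : (2 : ℝ) ≤ d := by exact_mod_cast hd
    calc Z ≤ 8 * d * N := by nlinarith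
      _ ≤ (8 * d * N) ^ r * 1 := by rw [mul_one]; exact hB
      _ ≤ _ := by gcongr
  have hNpos : 0 < N := by linarith
  have hM0 : (0 : ℝ) ≤ M := Nat.cast_nonneg _
  have hstep : ((α / 2 / 2) ^ E) ^ 2 * N ^ (r + 1) ≤ 6 * (8 * d) ^ r * D ^ 2 * M := by
    have hab : ((α / 2 / 2) ^ E * N ^ r) * ((α / 2 / 2) ^ E * N ^ r) ≤ a * b :=
      mul_le_mul (hX y₁ hy₁) (hX y₂ hy₂) (by positivity) (Nat.cast_nonneg _)
    refine le_of_mul_le_mul_right ?_ (pow_pos hNpos r)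
    calc ((α / 2 / 2) ^ E) ^ 2 * N ^ (r + 1) * N ^ r
        = ((α / 2 / 2) ^ E * N ^ r) * ((α / 2 / 2) ^ E * N ^ r) * N := by ring
      _ ≤ (a * b) * (2 * Z * D) := by gcongr
      _ = 2 * D * (a * b * Z) := by ring
      _ ≤ 2 * D * ((2 * (8 * d * N) ^ r * D + Z) * M) := by gcongr
      _ ≤ 2 * D * ((2 * (8 * d * N) ^ r * D + (8 * d * N) ^ r * D) * M) := by gcongr
      _ = _ := by rw [mul_pow]; ring
  have hnum := step_constants_le hd hr hβ (by positivity) hD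
  rw [← hE] at hnum
  set F := (32 * d) ^ (r + 1)
  set C : ℝ := 6 * (8 * d) ^ r * D ^ 2 with hC
  have hCpos : 0 < C := by
    have : (0 : ℝ) < d := by exact_mod_cast hd0
    positivity
  have h1 : (α / 2) ^ F * C ≤ ((α / 2 / 2) ^ E) ^ 2 := by
    have e1 : (α / 2) ^ F * (2 / α) ^ F = 1 := by
      rw [← mul_pow, show α / 2 * (2 / α) = 1 by field_simp, one_pow]
    have e2 : ((α / 2 / 2) ^ E) ^ 2 * ((2 * (2 / α)) ^ E) ^ 2 = 1 := by
      rw [← mul_pow, ← mul_pow, show α / 2 / 2 * (2 * (2 / α)) = 1 by field_simp, one_pow,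
        one_pow]
    calc (α / 2) ^ F * C
        = ((α / 2 / 2) ^ E) ^ 2 * (α / 2) ^ F * (((2 * (2 / α)) ^ E) ^ 2 * C) := by
          linear_combination (-((α / 2) ^ F * C)) * e2
      _ ≤ ((α / 2 / 2) ^ E) ^ 2 * (α / 2) ^ F * (2 / α) ^ F := by gcongr
      _ = _ := by rw [mul_assoc, e1, mul_one]
  refine le_of_mul_le_mul_left ?_ hCpos
  calc C * ((α / 2) ^ F * N ^ (r + 1)) = (α / 2) ^ F * C * N ^ (r + 1) := by ring
    _ ≤ ((α / 2 / 2) ^ E) ^ 2 * N ^ (r + 1) := by gcongr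
    _ ≤ _ := hstep

theorem mainTheorem6 (d r m : ℕ) (hd : 2 ≤ d) (hr : 1 ≤ r)
    (α : ℝ) (hα0 : 0 < α) (hα1 : α ≤ 1)
    (N : ℕ) (hNdef : N = d ^ m)
    (hN : (2 / α) ^ ((32 * d) ^ r) ≤ (N : ℝ))
    (t : Fin r → ℤ) (ht : ∀ j, |t j| ≤ (N : ℤ))
    (A : Finset (Fin r → Fin m → Fin 2))
    (hA : α * (2 : ℝ) ^ (m * r) ≤ (A.card : ℝ)) :
    (α / 2) ^ ((32 * d) ^ r) * (N : ℝ) ^ r ≤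
      (Set.ncard {x : ℤ | |x| ≤ ((8 * d * N : ℕ) : ℤ) ^ r ∧
        IsSignedSumOfAtMost ((4 * d) ^ r) (shiftedProducts d t A) x} : ℝ) := by
  subst hNdef
  have ht' : ∀ j, |t j| ≤ (d : ℤ) ^ m := fun j => by exact_mod_cast ht j
  clear ht
  change _ ≤ ((boundedSums d t A).ncard : ℝ)
  induction r, hr using Nat.le_induction generalizing α with
  | base => exact boundedSums_one hd hα0 hα1 t ht' A hA
  | succ r hr ih =>
    exact boundedSums_succ hd hr (fun α h0 h1 hN t ht A hA => ih α h0 h1 t A hA hN ht)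
      hα0 hα1 hN t ht' A hA
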